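/- Let $C$ be an algebraically closed field of characteristic zero, and let $\tau\subset C$ be a set of representatives of the cosets in $C/\mathbb Z$ with $\tau\cap\mathbb Z=\{0\}$. Let $R$ be a complete discrete valuation ring that is a $C$-algebra, with maximal ideal $\mathfrak r$ and residue field $C$ (so $R\simeq C[[t]]$). Put $R((x))=R[[x]][x^{-1}]$ and $\vartheta=x\frac{d}{dx}$. For $f=\sum_k f_kx^k\in R((x))$ let $\mathrm p(f)=\sum_{k<0}f_kx^k$, and let $\mathrm{dLog}\subset R[[x]]$ be the group of the series $\sum_{n\ge 0}a_nx^n$ with $a_0\in\mathbb Z$. A character is an element $\varphi$ of $R((x))/\mathrm{dLog}\simeq R[x^{-1}]/\mathbb Z$; put $\mathrm p(\varphi)=\mathrm p(f)$ for any representative $f$ of $\varphi$. A connection $(E,\nabla)$ over $R((x))$ is a finite $R((x))$-module $E$ with an $R$-linear map $\nabla:E\to E$ such that $\nabla(fe)=\vartheta(f)e+f\nabla(e)$. A TLJ-form of $(E,\nabla)$ over $R((x))$ is a decomposition $(E,\nabla)=\bigoplus_{\varphi\in\Phi}(E_\varphi,\nabla_\varphi)$ into subconnections indexed by a finite set $\Phi$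 of characters, such that for every $\varphi\in\Phi$ the following hold: $E_\varphi$ is generated over $R((x))$ by $\ker(\nabla-f)^q$ for some representative $f$ of $\varphi$ and all sufficiently large $q$; and $E_\varphi$ has an $R((x))$-basis in which, for some representative $f_\varphi$ of $\varphi$, the matrix of $\nabla_\varphi$ has all diagonal entries equal to $f_\varphi$, all entries directly below the diagonal in $\{0,1\}$, and all other entries $0$. Given a TLJ-form, the regular singular part $\nabla^{\rm rs}$ of $\nabla$ is the connection on $E$ that equals $\nabla_\varphi-\mathrm p(\varphi)$ on each $E_\varphi$; its restriction to $E_\varphi$ is denoted $\nabla^{\rm rs}_\varphi$. A Deligne–Manin lattice, with respect to $\tau$, of a connection $(E,\nabla)$ is a finite free $R[[x]]$-submodule $\mathcal E\subset E$ that generates $E$ over $R((x))$, satisfies $\nabla(\mathcal E)\subset\mathcal E$, and all of whose exponents, i.e. the eigenvalues of the map induced by $\nabla$ on the $C$-vector space $\mathcal E/(\mathfrak r,x)\mathcal E$, lie in $\tau$. **Proposition 4.11.** Let $(E,\nabla)$ be a connection over $R((x))$ without $R$-torsion that admits a TLJ-form $(E,\nabla)=\bigoplus_{\varphi\in\Phi}(E_\varphi,\nabla_\varphi)$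 over $R((x))$, and let $\mathcal E$ be a Deligne–Manin lattice of $(E,\nabla^{\rm rs})$ with respect to $\tau$. Then there is a decomposition $\mathcal E=\bigoplus_{\varphi\in\Phi}\mathcal E_\varphi$ such that, for every $\varphi\in\Phi$, $\mathcal E_\varphi\subset E_\varphi$ is a Deligne–Manin lattice of $(E_\varphi,\nabla^{\rm rs}_\varphi)$ with respect to $\tau$, i.e. with all exponents in $\tau$. -/

import Mathlib

open scoped LaurentSeries PowerSeries

namespace RelDisk

section Scalars

variable (R : Type*) [CommRing R]

/-- The derivation `ϑ = x d/dx` of `R((x))`: it sends `∑ aₙ xⁿ` to `∑ n aₙ xⁿ`. -/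
def euler : R⸨X⸩ →ₗ[R] R⸨X⸩ where
  toFun f :=
    { coeff := fun n => (n : R) * f.coeff n
      isPWO_support' := f.isPWO_support.mono fun n hn h => hn (by simp [h]) }
  map_add' f g := by
    ext n
    simp [mul_add]
  map_smul' r f := by
    ext n
    simp [mul_left_comm]

@[simp]
theorem coeff_euler (f : R⸨X⸩) (n : ℤ) : (euler R f).coeff n = (n : R) * f.coeff n := rfl

/-- On power series `ϑ` is `x` times the formal derivative. -/
theorem euler_algebraMap (f : R⟦X⟧) :
    euler R (algebraMap R⟦X⟧ R⸨X⸩ f) =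
      algebraMap R⟦X⟧ R⸨X⸩ (PowerSeries.X * PowerSeries.derivative R f) := by
  ext n
  rw [coeff_euler, LaurentSeries.coe_algebraMap]
  rcases lt_or_ge n 0 with hn | hn
  · have h : ∀ g : R⟦X⟧, (HahnSeries.ofPowerSeries ℤ R g).coeff n = 0 := fun g =>
      HahnSeries.embDomain_of_notMem_range (by rintro ⟨m, rfl⟩; simp at hn; omega)
    rw [h, h, mul_zero]
  · lift n to ℕ using hn
    rw [HahnSeries.ofPowerSeries_apply_coeff, HahnSeries.ofPowerSeries_apply_coeff]
    cases n with
    | zero => simp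
    | succ n => simp [PowerSeries.coeff_succ_X_mul, PowerSeries.coeff_derivative, mul_comm]

/-- The group `dLog` of Laurent series `∑_{n ≥ 0} aₙ xⁿ ∈ R[[x]]` with `a₀ ∈ ℤ`. -/
def dLog : AddSubgroup R⸨X⸩ where
  carrier := {f | (∀ n : ℤ, n < 0 → f.coeff n = 0) ∧ ∃ m : ℤ, f.coeff 0 = (m : R)}
  zero_mem' := ⟨fun n _ => by simp, 0, by simp⟩
  add_mem' := by
    rintro f g ⟨hf, a, ha⟩ ⟨hg, b, hb⟩
    exact ⟨fun n hn => by simp [hf n hn, hg n hn], a + b, by simp [ha, hb]⟩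
  neg_mem' := by
    rintro f ⟨hf, a, ha⟩
    exact ⟨fun n hn => by simp [hf n hn], -a, by simp [ha]⟩

/-- The group of characters `R((x)) / dLog`, which is `R[x⁻¹] / ℤ`: every class has a
representative in `R[x⁻¹]`, and two of those differ by an integer. -/
abbrev Character : Type _ := R⸨X⸩ ⧸ dLog R

/-- The principal part `p(f) = ∑_{k < 0} fₖ xᵏ` of a Laurent series. -/
def principalPart : R⸨X⸩ →+ R⸨X⸩ where
  toFun f :=
    { coeff := fun n => if n < 0 then f.coeff n else 0
      isPWO_support' := f.isPWO_support.mono fun n hn h => hn (by simp [h]) }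
  map_zero' := by
    ext n
    simp
  map_add' f g := by
    ext n
    by_cases h : n < 0 <;> simp [h]

/-- The principal part `p(φ)` of a character, i.e. the principal part of any representative. -/
def Character.principalPart : Character R →+ R⸨X⸩ :=
  QuotientAddGroup.lift (dLog R) (RelDisk.principalPart R) (by
    rintro f ⟨hf, -⟩
    ext n
    by_cases h : n < 0 <;> simp [RelDisk.principalPart, h, hf])

/-- `M` is a matrix `J♭_r(f)`: the entry `f` on the diagonal, entries `0` or `1` directly below
the diagonal, and `0` elsewhere. -/
def IsJordanFlat {R : Type*} [CommRing R] {r : ℕ} (f : R⸨X⸩)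
    (M : Matrix (Fin r) (Fin r) R⸨X⸩) : Prop :=
  (∀ i, M i i = f) ∧
    (∀ i j : Fin r, (i : ℕ) = j + 1 → M i j = 0 ∨ M i j = 1) ∧
    ∀ i j : Fin r, i ≠ j → (i : ℕ) ≠ j + 1 → M i j = 0

/-- `τ` is a set of representatives of the cosets in `C / ℤ` with `τ ∩ ℤ = {0}`. -/
def IsCosetSection {C : Type*} [Ring C] (τ : Set C) : Prop :=
  (∀ c : C, ∃! a : C, a ∈ τ ∧ ∃ n : ℤ, c - a = n) ∧
    τ ∩ Set.range (Int.cast : ℤ → C) = {0}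

end Scalars

/-- A connection on an `R((x))`-module `E`: an `R`-linear endomorphism satisfying Leibniz's rule
with respect to `ϑ`. -/
structure Connection (R E : Type*) [CommRing R] [AddCommGroup E] [Module R E]
    [Module R⸨X⸩ E] where
  /-- The underlying `R`-linear endomorphism. -/
  toLin : E →ₗ[R] E
  leibniz : ∀ (f : R⸨X⸩) (e : E), toLin (f • e) = euler R f • e + f • toLin e

section Connections

variable {R E : Type*} [CommRing R] [AddCommGroup E] [Module R E] [Module R⸨X⸩ E]
  [IsScalarTower R R⸨X⸩ E]

/-- The endomorphism `∇ - f`. -/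
noncomputable def Connection.subScalar (D : Connection R E) (f : R⸨X⸩) : Module.End R E :=
  D.toLin - (LinearMap.lsmul R⸨X⸩ E f).restrictScalars R

/-- The connection induced on a submodule that is stable under `∇`. -/
noncomputable def Connection.restrict (D : Connection R E) (N : Submodule R⸨X⸩ E)
    (hN : ∀ e ∈ N, D.toLin e ∈ N) : Connection R N where
  toLin := D.toLin.restrict (p := N.restrictScalars R) (q := N.restrictScalars R) hN
  leibniz f e := Subtype.ext (D.leibniz f e)

/-- The connection `∇ - P`, for `P` an `R((x))`-linear endomorphism. -/
noncomputable def Connection.subLinear (D : Connection R E) (P : E →ₗ[R⸨X⸩] E) : Connection R E where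
  toLin := D.toLin - P.restrictScalars R
  leibniz f e := by
    simp only [LinearMap.sub_apply, LinearMap.restrictScalars_apply, D.leibniz, map_smul, smul_sub]
    abel

/-- The matrix of `∇` in a basis `b`; its `j`-th column is `∇ (b j)`. -/
noncomputable def Connection.mat (D : Connection R E) {ι : Type*} (b : Module.Basis ι R⸨X⸩ E) :
    Matrix ι ι R⸨X⸩ :=
  Matrix.of fun i j => b.repr (D.toLin (b j)) i

/-- A Turrittin-Levelt-Jordan form of `(E, ∇)` over `R((x))`: a finite set `Φ` of characters and a
decomposition of `(E, ∇)` into subconnections `E_φ`, such that `E_φ` is generated over `R((x))` by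
`ker (∇ - f)^q`, for a representative `f` of `φ` and `q` large enough, and has a basis in which the
matrix of `∇` is `J♭(f)`, for a representative `f` of `φ`. -/
structure TLJForm (D : Connection R E) where
  /-- The set of characters. -/
  Φ : Finset (Character R)
  /-- The component `E_φ`. -/
  comp : Φ → Submodule R⸨X⸩ E
  stable : ∀ φ, ∀ e ∈ comp φ, D.toLin e ∈ comp φ
  iSupIndep : iSupIndep comp
  iSup_eq_top : ⨆ φ, comp φ = ⊤
  generated : ∀ φ : Φ, ∃ f : R⸨X⸩, (f : Character R) = φ ∧ ∃ q₀ : ℕ, ∀ q ≥ q₀,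
    comp φ = Submodule.span R⸨X⸩ {e : E | (D.subScalar f ^ q) e = 0}
  jordan : ∀ φ : Φ, ∃ f : R⸨X⸩, (f : Character R) = φ ∧
    ∃ (r : ℕ) (b : Module.Basis (Fin r) R⸨X⸩ (comp φ)),
      IsJordanFlat f ((D.restrict (comp φ) (stable φ)).mat b)

namespace TLJForm

variable {D : Connection R E} (T : TLJForm D)

open Classical in
theorem bijective_coeLinearMap : Function.Bijective (DirectSum.coeLinearMap T.comp) :=
  (DirectSum.isInternal_submodule_iff_iSupIndep_and_iSup_eq_top T.comp).2
    ⟨T.iSupIndep, T.iSup_eq_top⟩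

open Classical in
/-- The `R((x))`-linear endomorphism `P_∇` of `E = ⨁ E_φ` that is multiplication by the principal
part `p(φ)` on each `E_φ`. -/
noncomputable def irr : E →ₗ[R⸨X⸩] E :=
  DirectSum.toModule R⸨X⸩ T.Φ E
      (fun φ => (Character.principalPart R (φ : Character R)) • (T.comp φ).subtype) ∘ₗ
    (LinearEquiv.ofBijective (DirectSum.coeLinearMap T.comp)
      T.bijective_coeLinearMap).symm.toLinearMap

open Classical in
theorem irr_apply {φ : T.Φ} {e : E} (he : e ∈ T.comp φ) :
    T.irr e = Character.principalPart R (φ : Character R) • e := by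
  have h : (LinearEquiv.ofBijective (DirectSum.coeLinearMap T.comp)
      T.bijective_coeLinearMap).symm e =
      DirectSum.lof R⸨X⸩ T.Φ (fun φ => T.comp φ) φ ⟨e, he⟩ := by
    rw [LinearEquiv.symm_apply_eq]
    simp
  simp only [irr, LinearMap.comp_apply, LinearEquiv.coe_coe, h, DirectSum.toModule_lof]
  simp

/-- The regular singular part `∇^rs = ∇ - P_∇` of `∇`; it is `∇ - p(φ)` on `E_φ`. -/
noncomputable def rs : Connection R E := D.subLinear T.irr

theorem rs_apply {φ : T.Φ} {e : E} (he : e ∈ T.comp φ) :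
    T.rs.toLin e = D.toLin e - Character.principalPart R (φ : Character R) • e := by
  rw [← T.irr_apply he]
  rfl

theorem rs_stable (φ : T.Φ) : ∀ e ∈ T.comp φ, T.rs.toLin e ∈ T.comp φ := fun e he => by
  rw [T.rs_apply he]
  exact sub_mem (T.stable φ e he) ((T.comp φ).smul_mem _ he)

/-- The connection `∇^rs_φ` on `E_φ`, the restriction of `∇^rs`. -/
noncomputable def rsComp (φ : T.Φ) : Connection R (T.comp φ) :=
  T.rs.restrict (T.comp φ) (T.rs_stable φ)

end TLJForm

end Connections

section Lattices

variable {R E : Type*} [CommRing R] [AddCommGroup E] [Module R E] [Module R⟦X⟧ E]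
  [Module R⸨X⸩ E] [IsScalarTower R R⟦X⟧ E] [IsScalarTower R⟦X⟧ R⸨X⸩ E]

/-- A logarithmic lattice of `(E, ∇)`: a finite free `R[[x]]`-submodule `L` of `E` that generates
`E` over `R((x))` and is stable under `∇`. A free `R[[x]]`-module embeds into its localization at
`x`, so these are the finite free `R[[x]]`-modules with a logarithmic connection
together with an isomorphism of their localization at `x` with `(E, ∇)`. -/
structure IsLogLattice (D : Connection R E) (L : Submodule R⟦X⟧ E) : Prop where
  finite : Module.Finite R⟦X⟧ L
  free : Module.Free R⟦X⟧ L
  span_eq_top : Submodule.span R⸨X⸩ (L : Set E) = ⊤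
  stable : ∀ e ∈ L, D.toLin e ∈ L

variable [IsLocalRing R]

variable (R) in
/-- The ideal `(𝔯, x)` of `R[[x]]`, where `𝔯` is the maximal ideal of `R`. -/
noncomputable def specialIdeal : Ideal R⟦X⟧ :=
  (IsLocalRing.maximalIdeal R).map (PowerSeries.C (R := R)) ⊔ Ideal.span {PowerSeries.X}

/-- The `R`-submodule `(𝔯, x) L` of `L`. -/
noncomputable def specialSubmodule (L : Submodule R⟦X⟧ E) : Submodule R L :=
  (specialIdeal R • (⊤ : Submodule R⟦X⟧ L)).restrictScalars R

/-- The endomorphism of a lattice induced by the connection. -/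
noncomputable def IsLogLattice.endo {D : Connection R E} {L : Submodule R⟦X⟧ E} (h : IsLogLattice D L) :
    L →ₗ[R] L :=
  D.toLin.restrict (p := L.restrictScalars R) (q := L.restrictScalars R) h.stable

theorem IsLogLattice.endo_mem {D : Connection R E} {L : Submodule R⟦X⟧ E}
    (h : IsLogLattice D L) : specialSubmodule L ≤ (specialSubmodule L).comap h.endo := by
  intro v hv
  rw [Submodule.mem_comap]
  rw [specialSubmodule, Submodule.restrictScalars_mem] at hv ⊢
  refine Submodule.smul_induction_on hv (fun f hf w _ => ?_) (fun v w hv hw => ?_)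
  · have key : h.endo (f • w) =
        (PowerSeries.X * PowerSeries.derivative R f) • w + f • h.endo w := by
      apply Subtype.ext
      change D.toLin (f • (w : E)) =
        (PowerSeries.X * PowerSeries.derivative R f) • (w : E) + f • D.toLin (w : E)
      rw [← algebraMap_smul R⸨X⸩ f (w : E), D.leibniz, euler_algebraMap, algebraMap_smul,
        algebraMap_smul]
    rw [key]
    refine add_mem (Submodule.smul_mem_smul ?_ trivial) (Submodule.smul_mem_smul hf trivial)
    exact Ideal.mul_mem_right _ _
      (Ideal.mem_sup_right (Ideal.subset_span (Set.mem_singleton _)))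
  · rw [map_add]
    exact add_mem hv hw

/-- The reduced residue `L / (𝔯, x) L → L / (𝔯, x) L` induced by `∇`. -/
noncomputable def IsLogLattice.reducedResidue {D : Connection R E} {L : Submodule R⟦X⟧ E}
    (h : IsLogLattice D L) : Module.End R (L ⧸ specialSubmodule L) :=
  (specialSubmodule L).mapQ (specialSubmodule L) h.endo h.endo_mem

/-- The (reduced) exponents of a lattice: the eigenvalues in the coefficient field `C` of the
reduced residue. -/
def IsLogLattice.exponents (C : Type*) [Field C] [Algebra C R] {D : Connection R E}
    {L : Submodule R⟦X⟧ E} (h : IsLogLattice D L) : Set C :=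
  {c | h.reducedResidue.HasEigenvalue (algebraMap C R c)}

/-- A Deligne-Manin lattice of `(E, ∇)` with respect to `τ`: a logarithmic lattice all of whose
exponents lie in `τ`. -/
def IsDeligneManinLattice {C : Type*} [Field C] [Algebra C R] (τ : Set C) (D : Connection R E)
    (L : Submodule R⟦X⟧ E) : Prop :=
  ∃ h : IsLogLattice D L, h.exponents C ⊆ τ

end Lattices

end RelDisk

namespace RelDisk

set_option linter.unusedSectionVars false

/-! A Deligne–Manin lattice is unique, so it suffices to build one that is visibly decomposed.

Existence on each `E_φ`: subtracting `p(φ)` from the Jordan matrix leaves a matrix of the same shape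
whose diagonal entry `g` lies in `R[[x]]`. Multiplying the basis by `x^k` adds `k` to the diagonal,
and a suitable integer `k` moves the constant term of `g`, reduced modulo `𝔯`, to its representative
`a ∈ τ`. The span of the rescaled basis is a logarithmic lattice with `(∇ - a)^r` carrying it into
`(𝔯, x)` times itself (`Connection.exists_isLogLattice_of_isJordanFlat`). The sum of these lattices
over `φ` is a lattice `M` of `(E, ∇^rs)`.

Uniqueness (`Connection.le_of_isCoprime`): exponents enter only through polynomials. Write `J = (𝔯,
x)`, and let `p₁(∇)`, `p₂(∇)` map `L₁`, `L₂` into `J L₁`, `J L₂`, with all roots in `τ`. Some `x^N`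
maps `L₁` into `L₂`, and it intertwines `∇` with `∇ - N`. For `N > 0` the polynomials `p₁(X - N)`
and `p₂` are coprime, since two elements of `τ` never differ by a nonzero integer. A Bézout relation
then improves `x^N L₁ ⊆ (J^k + (x)) L₂` to the same inclusion for `k + 1`
(`Connection.X_pow_smul_mem_pow_smul`). Krull's intersection theorem gives `x^N L₁ ⊆ x L₂`;
cancelling `x` lowers `N`, down to `L₁ ⊆ L₂`. Applying this both ways to `M` and the given lattice
yields equality. -/

open Polynomial in
theorem map_aeval_apply_of_comm {R M N : Type*} [CommRing R] [AddCommGroup M] [Module R M]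
    [AddCommGroup N] [Module R N] (u : M →ₗ[R] N) (S : Module.End R M) (T : Module.End R N)
    (h : ∀ v, u (S v) = T (u v)) (p : R[X]) (v : M) : u (aeval S p v) = aeval T p (u v) := by
  have hp (n : ℕ) (v : M) : u ((S ^ n) v) = (T ^ n) (u v) := by
    induction n generalizing v with
    | zero => simp
    | succ n ih => rw [pow_succ, pow_succ, Module.End.mul_apply, Module.End.mul_apply, ih, h]
  induction p using Polynomial.induction_on' with
  | add p q hp hq => simp [hp, hq]
  | monomial n a => simp [aeval_monomial, hp]

open Polynomial in
theorem aeval_apply_mem_of_stable {R M : Type*} [CommRing R] [AddCommGroup M] [Module R M]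
    (T : Module.End R M) (N : Submodule R M) (h : ∀ v ∈ N, T v ∈ N) (p : R[X]) {v : M}
    (hv : v ∈ N) : aeval T p v ∈ N := by
  have hp := map_aeval_apply_of_comm N.subtype (T.restrict h) T (fun _ => rfl) p ⟨v, hv⟩
  rw [Submodule.subtype_apply, Submodule.subtype_apply] at hp
  exact hp ▸ Subtype.property _

/-! ### The ideal `(𝔯, x)` and its residue field -/

section Special

variable {R : Type*} [CommRing R] [IsLocalRing R]

theorem X_mem_specialIdeal : (PowerSeries.X : R⟦X⟧) ∈ specialIdeal R :=
  Ideal.mem_sup_right (Ideal.subset_span (Set.mem_singleton _))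

theorem mem_specialIdeal_iff {f : R⟦X⟧} :
    f ∈ specialIdeal R ↔ PowerSeries.constantCoeff f ∈ IsLocalRing.maximalIdeal R := by
  constructor
  · intro hf
    have h : specialIdeal R ≤ (IsLocalRing.maximalIdeal R).comap PowerSeries.constantCoeff := by
      refine sup_le (Ideal.map_le_iff_le_comap.2 fun r hr => ?_) ?_
      · simpa using hr
      · rw [Ideal.span_singleton_le_iff_mem]
        simp
    exact h hf
  · intro hf
    obtain ⟨g, hg⟩ : (PowerSeries.X : R⟦X⟧) ∣
        f - PowerSeries.C (PowerSeries.constantCoeff f) := by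
      rw [PowerSeries.X_dvd_iff]; simp
    rw [sub_eq_iff_eq_add'.1 hg]
    exact add_mem (Ideal.mem_sup_left (Ideal.mem_map_of_mem _ hf))
      (Ideal.mul_mem_right _ _ X_mem_specialIdeal)

theorem specialIdeal_ne_top : specialIdeal R ≠ ⊤ := by
  rw [Ne, Ideal.eq_top_iff_one, mem_specialIdeal_iff, map_one]
  exact (Ideal.ne_top_iff_one _).1 (IsLocalRing.maximalIdeal.isMaximal R).ne_top

theorem exists_sub_C_mem_specialIdeal {C : Type*} [Field C] [Algebra C R]
    (hR : Function.Surjective (algebraMap C (IsLocalRing.ResidueField R))) (f : R⟦X⟧) :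
    ∃ c : C, f - PowerSeries.C (algebraMap C R c) ∈ specialIdeal R := by
  obtain ⟨c, hc⟩ := hR (IsLocalRing.residue R (PowerSeries.constantCoeff f))
  refine ⟨c, ?_⟩
  rw [mem_specialIdeal_iff, map_sub, PowerSeries.constantCoeff_C, ← IsLocalRing.residue_eq_zero_iff,
    map_sub, ← hc, sub_eq_zero]
  rfl

end Special

theorem powerSeries_C_smul {R E : Type*} [CommRing R] [AddCommGroup E] [Module R E]
    [Module R⟦X⟧ E] [IsScalarTower R R⟦X⟧ E] (r : R) (v : E) : (PowerSeries.C r : R⟦X⟧) • v = r • v := by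
  rw [← algebraMap_smul R⟦X⟧ r v]
  rfl

/-! ### Polynomials in `∇` acting on a stable lattice -/

section Action

variable {R E : Type*} [CommRing R] [AddCommGroup E] [Module R E] [Module R⟦X⟧ E]
  [Module R⸨X⸩ E] [IsScalarTower R R⟦X⟧ E] [IsScalarTower R⟦X⟧ R⸨X⸩ E]

theorem Connection.toLin_powerSeries_smul (D : Connection R E) (f : R⟦X⟧) (v : E) :
    D.toLin (f • v) =
      (PowerSeries.X : R⟦X⟧) • (PowerSeries.derivative R f • v) + f • D.toLin v := by
  rw [← algebraMap_smul R⸨X⸩ f v, D.leibniz, euler_algebraMap, algebraMap_smul,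
    algebraMap_smul R⸨X⸩ f, smul_smul]

theorem Connection.toLin_X_pow_smul (D : Connection R E) (N : ℕ) (v : E) :
    D.toLin ((PowerSeries.X : R⟦X⟧) ^ N • v) =
      (PowerSeries.X : R⟦X⟧) ^ N • (D.toLin v + (N : R) • v) := by
  rw [D.toLin_powerSeries_smul, smul_add, add_comm, ← powerSeries_C_smul (N : R) v, smul_smul, smul_smul]
  congr 2
  rw [Derivation.leibniz_pow]
  cases N with
  | zero => simp
  | succ n => simp [pow_succ]; ring

theorem Connection.toLin_mem_smul (D : Connection R E) {L : Submodule R⟦X⟧ E}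
    (hL : ∀ e ∈ L, D.toLin e ∈ L) {I : Ideal R⟦X⟧} (hI : PowerSeries.X ∈ I) {v : E}
    (hv : v ∈ I • L) : D.toLin v ∈ I • L := by
  refine Submodule.smul_induction_on hv (fun f hf w hw => ?_) (fun v w hv hw => ?_)
  · rw [D.toLin_powerSeries_smul]
    exact add_mem (Submodule.smul_mem_smul hI (L.smul_mem _ hw))
      (Submodule.smul_mem_smul hf (hL _ hw))
  · rw [map_add]
    exact add_mem hv hw

open Polynomial in
theorem Connection.aeval_mem (D : Connection R E) {L : Submodule R⟦X⟧ E}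
    (hL : ∀ e ∈ L, D.toLin e ∈ L) (p : R[X]) {v : E} (hv : v ∈ L) : aeval D.toLin p v ∈ L :=
  aeval_apply_mem_of_stable D.toLin (L.restrictScalars R) hL p hv

-- Since `ϑ` maps `R[[x]]` into `x R[[x]]`, Leibniz's rule makes `∇`, and hence every polynomial in
-- it, `R[[x]]`-linear modulo `x`.
open Polynomial in
theorem Connection.aeval_smul_sub_mem (D : Connection R E) {L : Submodule R⟦X⟧ E}
    (hL : ∀ e ∈ L, D.toLin e ∈ L) (p : R[X]) (f : R⟦X⟧) {v : E} (hv : v ∈ L) :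
    aeval D.toLin p (f • v) - f • aeval D.toLin p v ∈
      Ideal.span {(PowerSeries.X : R⟦X⟧)} • L := by
  have hX : (PowerSeries.X : R⟦X⟧) ∈ Ideal.span {(PowerSeries.X : R⟦X⟧)} :=
    Ideal.subset_span (Set.mem_singleton _)
  have hp (n : ℕ) : (D.toLin ^ n) (f • v) - f • (D.toLin ^ n) v ∈
      Ideal.span {(PowerSeries.X : R⟦X⟧)} • L := by
    induction n with
    | zero => simp
    | succ n ih =>
      have hn : (D.toLin ^ n) v ∈ L := by simpa using D.aeval_mem hL (X ^ n) hv
      have h := D.toLin_mem_smul hL hX ih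
      rw [map_sub, D.toLin_powerSeries_smul] at h
      rw [pow_succ', Module.End.mul_apply, Module.End.mul_apply]
      have h' := add_mem h (Submodule.smul_mem_smul hX
        (L.smul_mem (PowerSeries.derivative R f) hn))
      convert h' using 1
      abel
  induction p using Polynomial.induction_on' with
  | add p q hp hq =>
    convert add_mem hp hq using 1
    simp only [map_add, LinearMap.add_apply, smul_add]
    abel
  | monomial n a =>
    have h := Submodule.smul_of_tower_mem (Ideal.span {(PowerSeries.X : R⟦X⟧)} • L) a (hp n)
    convert h using 1
    simp only [aeval_monomial, Module.algebraMap_end_eq_smul_id, smul_sub,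
      Module.End.mul_apply, LinearMap.smul_apply, LinearMap.id_apply]
    rw [← powerSeries_C_smul a, ← powerSeries_C_smul a, ← powerSeries_C_smul a, smul_comm f]

open Polynomial in
theorem Connection.aeval_mem_smul (D : Connection R E) {L : Submodule R⟦X⟧ E}
    (hL : ∀ e ∈ L, D.toLin e ∈ L) {J : Ideal R⟦X⟧} (p : R[X])
    (hp : ∀ v ∈ L, aeval D.toLin p v ∈ J • L) (I : Ideal R⟦X⟧) {v : E} (hv : v ∈ I • L) :
    aeval D.toLin p v ∈ (I * J ⊔ Ideal.span {(PowerSeries.X : R⟦X⟧)}) • L := by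
  refine Submodule.smul_induction_on hv (fun f hf w hw => ?_) (fun v w hv hw => ?_)
  · rw [← sub_add_cancel (aeval D.toLin p (f • w)) (f • aeval D.toLin p w), Submodule.sup_smul]
    refine add_mem (Submodule.mem_sup_right (D.aeval_smul_sub_mem hL p f hw))
      (Submodule.mem_sup_left ?_)
    rw [Submodule.mul_smul]
    exact Submodule.smul_mem_smul hf (hp w hw)
  · rw [map_add]
    exact add_mem hv hw

end Action

/-! ### Comparison of two lattices -/

section Uniqueness

variable {R E : Type*} [CommRing R] [AddCommGroup E] [Module R E] [Module R⟦X⟧ E]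
  [Module R⸨X⸩ E] [IsScalarTower R R⟦X⟧ E] [IsScalarTower R⟦X⟧ R⸨X⸩ E]

-- Induction on `k`: in the Bézout relation applied to `x^N v`, the term with `p₁` gains a factor
-- `J` inside `L₁`, the term with `p₂` gains it inside `L₂`. The ideal `(x)` absorbs the failure of
-- `p₂(∇)` to be `R[[x]]`-linear.
open Polynomial in
theorem Connection.X_pow_smul_mem_pow_smul (D : Connection R E) {L₁ L₂ : Submodule R⟦X⟧ E}
    (h₁ : ∀ e ∈ L₁, D.toLin e ∈ L₁) (h₂ : ∀ e ∈ L₂, D.toLin e ∈ L₂) {J : Ideal R⟦X⟧} {p₁ p₂ : R[X]}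
    (hp₁ : ∀ v ∈ L₁, aeval D.toLin p₁ v ∈ J • L₁) (hp₂ : ∀ v ∈ L₂, aeval D.toLin p₂ v ∈ J • L₂)
    (N : ℕ) (hp : IsCoprime (p₁.comp (X - C (N : R))) p₂)
    (hN : ∀ v ∈ L₁, (PowerSeries.X : R⟦X⟧) ^ N • v ∈ L₂) (k : ℕ) :
    ∀ v ∈ L₁, (PowerSeries.X : R⟦X⟧) ^ N • v ∈
      (J ^ k ⊔ Ideal.span {(PowerSeries.X : R⟦X⟧)}) • L₂ := by
  set I : ℕ → Ideal R⟦X⟧ := fun k => J ^ k ⊔ Ideal.span {(PowerSeries.X : R⟦X⟧)} with hI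
  have hXI (k : ℕ) : (PowerSeries.X : R⟦X⟧) ∈ I k :=
    Ideal.mem_sup_right (Ideal.subset_span (Set.mem_singleton _))
  have hmul (k : ℕ) : I k * J ⊔ Ideal.span {(PowerSeries.X : R⟦X⟧)} ≤ I (k + 1) := by
    refine sup_le ?_ le_sup_right
    simp only [hI, Ideal.sup_mul, pow_succ]
    exact sup_le_sup_left Ideal.mul_le_left _
  have hstab (k : ℕ) (p : R[X]) {w : E} (hw : w ∈ I k • L₂) : aeval D.toLin p w ∈ I k • L₂ :=
    D.aeval_mem (fun e he => D.toLin_mem_smul h₂ (hXI k) he) p hw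
  obtain ⟨a, b, hab⟩ := hp
  let u : E →ₗ[R⟦X⟧] E := LinearMap.lsmul R⟦X⟧ E (PowerSeries.X ^ N)
  have hu (v : E) : (PowerSeries.X : R⟦X⟧) ^ N • v = u v := rfl
  have hcomm (v : E) : u (D.toLin v) = (D.toLin - algebraMap R (Module.End R E) N) (u v) := by
    rw [LinearMap.sub_apply, ← hu, ← hu, D.toLin_X_pow_smul, smul_add,
      Module.algebraMap_end_apply, ← powerSeries_C_smul (N : R), ← powerSeries_C_smul (N : R),
      smul_comm (PowerSeries.C (N : R)), add_sub_cancel_right]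
  have hcomm' (p : R[X]) (v : E) :
      u (aeval D.toLin p v) = aeval D.toLin (p.comp (X - C (N : R))) (u v) := by
    rw [aeval_comp]
    simpa using map_aeval_apply_of_comm (u.restrictScalars R) D.toLin _ hcomm p v
  induction k with
  | zero => simpa [hI] using hN
  | succ k ih =>
    have hmap : L₁.map u ≤ I k • L₂ := by
      rintro _ ⟨v, hv, rfl⟩
      exact ih v hv
    intro v hv
    -- Moving a polynomial in `∇` across `u` replaces `X` by `X - N`; `a` is shifted by `+N` to
    -- cancel this, so the first term is `(a · p₁(X - N))(∇)` applied to `u v`.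
    have hdec : u v = u (aeval D.toLin (p₁ * a.comp (X + C (N : R))) v) +
        aeval D.toLin b (aeval D.toLin p₂ (u v)) := by
      have hcomp : (p₁ * a.comp (X + C (N : R))).comp (X - C (N : R)) =
          a * p₁.comp (X - C (N : R)) := by
        rw [mul_comp, comp_assoc, mul_comm]
        simp
      rw [hcomm', hcomp, ← Module.End.mul_apply, ← map_mul, ← LinearMap.add_apply, ← map_add, hab,
        map_one, Module.End.one_apply]
    rw [hu, hdec]
    refine add_mem ?_ (hstab (k + 1) b ?_)
    · rw [map_mul, Module.End.mul_apply]
      have h := Submodule.mem_map_of_mem (f := u)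
        (hp₁ _ (D.aeval_mem h₁ (a.comp (X + C (N : R))) hv))
      rw [Submodule.map_smul''] at h
      have h' := Submodule.smul_mono le_rfl hmap h
      rw [← Submodule.mul_smul, mul_comm] at h'
      exact Submodule.smul_mono_left (le_sup_left.trans (hmul k)) h'
    · exact Submodule.smul_mono_left (hmul k) (D.aeval_mem_smul h₂ p₂ hp₂ (I k) (ih v hv))

/-- Krull's intersection theorem for the finite module `L / I L`. -/
theorem iInf_pow_sup_smul_le {A M : Type*} [CommRing A] [IsNoetherianRing A] [IsLocalRing A]
    [AddCommGroup M] [Module A M] {J : Ideal A} (hJ : J ≠ ⊤) (I : Ideal A) (L : Submodule A M)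
    [Module.Finite A L] : ⨅ k : ℕ, (J ^ k ⊔ I) • L ≤ I • L := by
  intro v hv
  rw [Submodule.mem_iInf] at hv
  have hvL : v ∈ L := Submodule.smul_le_right (hv 0)
  have hmem (K : Ideal A) (w : L) : w ∈ K • (⊤ : Submodule A L) ↔ (w : M) ∈ K • L := by
    have h : (K • (⊤ : Submodule A L)).map L.subtype = K • L := by
      rw [Submodule.map_smul'', Submodule.map_subtype_top]
    rw [← h, Submodule.mem_map]
    exact ⟨fun hw => ⟨w, hw, rfl⟩, fun ⟨w', hw', e⟩ => Subtype.ext e ▸ hw'⟩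
  rw [← hmem I ⟨v, hvL⟩, ← Submodule.Quotient.mk_eq_zero, ← Submodule.mem_bot A,
    ← Ideal.iInf_pow_smul_eq_bot_of_isLocalRing J hJ, Submodule.mem_iInf]
  intro k
  have h := Submodule.mem_map_of_mem (f := (I • (⊤ : Submodule A L)).mkQ)
    ((hmem _ ⟨v, hvL⟩).2 (hv k))
  rw [Submodule.sup_smul, Submodule.map_sup, Submodule.mkQ_map_self, sup_bot_eq,
    Submodule.map_smul''] at h
  exact Submodule.smul_mono le_rfl le_top h

theorem X_smul_injective : Function.Injective fun v : E => (PowerSeries.X : R⟦X⟧) • v := by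
  intro v w h
  have hX : (HahnSeries.single (-1) 1 : R⸨X⸩) * algebraMap R⟦X⟧ R⸨X⸩ PowerSeries.X = 1 := by
    simp [LaurentSeries.coe_algebraMap]
  have h' : algebraMap R⟦X⟧ R⸨X⸩ PowerSeries.X • v = algebraMap R⟦X⟧ R⸨X⸩ PowerSeries.X • w := by
    rw [algebraMap_smul, algebraMap_smul]
    exact h
  rw [← one_smul R⸨X⸩ v, ← one_smul R⸨X⸩ w, ← hX, mul_smul, mul_smul, h']

theorem exists_X_pow_mul_eq_algebraMap (f : R⸨X⸩) :
    ∃ (N : ℕ) (g : R⟦X⟧),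
      algebraMap R⟦X⟧ R⸨X⸩ (PowerSeries.X ^ N) * f = algebraMap R⟦X⟧ R⸨X⸩ g := by
  obtain ⟨⟨g, ⟨_, N, rfl⟩⟩, h⟩ := IsLocalization.surj (Submonoid.powers (PowerSeries.X : R⟦X⟧)) f
  exact ⟨N, g, by rw [mul_comm]; exact h⟩

theorem exists_X_pow_smul_mem {L : Submodule R⟦X⟧ E}
    (hL : Submodule.span R⸨X⸩ (L : Set E) = ⊤) (v : E) :
    ∃ N : ℕ, (PowerSeries.X : R⟦X⟧) ^ N • v ∈ L := by
  have hv : v ∈ Submodule.span R⸨X⸩ (L : Set E) := hL ▸ Submodule.mem_top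
  induction hv using Submodule.span_induction with
  | mem v hv => exact ⟨0, by simpa using hv⟩
  | zero => exact ⟨0, by simp⟩
  | add v w _ _ hv hw =>
    obtain ⟨m, hm⟩ := hv
    obtain ⟨n, hn⟩ := hw
    refine ⟨m + n, ?_⟩
    rw [smul_add]
    refine add_mem ?_ ?_
    · rw [add_comm, pow_add, mul_smul]
      exact L.smul_mem _ hm
    · rw [pow_add, mul_smul]
      exact L.smul_mem _ hn
  | smul f v _ hv =>
    obtain ⟨m, hm⟩ := hv
    obtain ⟨n, g, hg⟩ := exists_X_pow_mul_eq_algebraMap f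
    refine ⟨m + n, ?_⟩
    have h : (PowerSeries.X : R⟦X⟧) ^ (m + n) • f • v = g • (PowerSeries.X : R⟦X⟧) ^ m • v := by
      rw [pow_add, mul_smul, ← algebraMap_smul R⸨X⸩ (PowerSeries.X ^ n : R⟦X⟧) (f • v), smul_smul, hg,
        algebraMap_smul, smul_comm]
    rw [h]
    exact L.smul_mem _ hm

theorem exists_X_pow_smul_mem_of_finite {L₁ L₂ : Submodule R⟦X⟧ E} [Module.Finite R⟦X⟧ L₁]
    (h₂ : Submodule.span R⸨X⸩ (L₂ : Set E) = ⊤) :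
    ∃ N : ℕ, ∀ v ∈ L₁, (PowerSeries.X : R⟦X⟧) ^ N • v ∈ L₂ := by
  obtain ⟨s, hs⟩ := (Module.Finite.iff_fg (N := L₁)).1 inferInstance
  choose N hN using exists_X_pow_smul_mem h₂
  refine ⟨s.sup N, fun v hv => ?_⟩
  have h : L₁ ≤ L₂.comap (LinearMap.lsmul R⟦X⟧ E (PowerSeries.X ^ s.sup N)) := by
    rw [← hs, Submodule.span_le]
    intro w hw
    change (PowerSeries.X : R⟦X⟧) ^ s.sup N • w ∈ L₂
    rw [← Nat.sub_add_cancel (Finset.le_sup (f := N) hw), pow_add, mul_smul]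
    exact L₂.smul_mem _ (hN w)
  exact h hv

variable [IsLocalRing R] [IsNoetherianRing R]

open Polynomial in
/-- A lattice whose exponents do not exceed those of another one by a positive integer is contained
in it. -/
theorem Connection.le_of_isCoprime (D : Connection R E) {L₁ L₂ : Submodule R⟦X⟧ E}
    [Module.Finite R⟦X⟧ L₁] [Module.Finite R⟦X⟧ L₂]
    (h₁ : ∀ e ∈ L₁, D.toLin e ∈ L₁) (h₂ : ∀ e ∈ L₂, D.toLin e ∈ L₂)
    (hs : Submodule.span R⸨X⸩ (L₂ : Set E) = ⊤) {p₁ p₂ : R[X]}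
    (hp₁ : ∀ v ∈ L₁, aeval D.toLin p₁ v ∈ specialIdeal R • L₁)
    (hp₂ : ∀ v ∈ L₂, aeval D.toLin p₂ v ∈ specialIdeal R • L₂)
    (hp : ∀ N : ℕ, N ≠ 0 → IsCoprime (p₁.comp (X - C (N : R))) p₂) : L₁ ≤ L₂ := by
  obtain ⟨N, hN⟩ := exists_X_pow_smul_mem_of_finite (L₁ := L₁) hs
  -- Descent: as long as the exponent is positive, `x^(N+1) L₁ ⊆ x L₂`, and `x` acts injectively on
  -- `E`.
  induction N with
  | zero => exact fun v hv => by simpa using hN v hv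
  | succ N ih =>
    refine ih fun v hv => ?_
    have h : (PowerSeries.X : R⟦X⟧) ^ (N + 1) • v ∈
        Ideal.span {(PowerSeries.X : R⟦X⟧)} • L₂ :=
      iInf_pow_sup_smul_le specialIdeal_ne_top _ L₂ (Submodule.mem_iInf _ |>.2 fun k =>
        D.X_pow_smul_mem_pow_smul h₁ h₂ hp₁ hp₂ (N + 1) (hp _ N.succ_ne_zero) hN k v hv)
    rw [Submodule.ideal_span_singleton_smul, Submodule.mem_smul_pointwise_iff_exists] at h
    obtain ⟨w, hw, h⟩ := h
    rw [pow_succ', mul_smul] at h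
    exact X_smul_injective h ▸ hw

end Uniqueness

-- A common root `x` would put both `x` and `x - N` in `τ`; they represent the same coset of `ℤ`, so
-- `N = 0`.
open Polynomial in
theorem isCoprime_comp_X_sub_C {k : Type*} [Field k] [IsAlgClosed k] [CharZero k] {τ : Set k}
    (hτ : IsCosetSection τ) {p₁ p₂ : k[X]} (h₁ : ∀ c, p₁.IsRoot c → c ∈ τ)
    (h₂ : ∀ c, p₂.IsRoot c → c ∈ τ) {N : ℕ} (hN : N ≠ 0) :
    IsCoprime (p₁.comp (X - C (N : k))) p₂ := by
  rw [Polynomial.isCoprime_iff_aeval_ne_zero_of_isAlgClosed k k]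
  intro x
  by_contra! h
  simp only [coe_aeval_eq_eval, eval_comp, eval_sub, eval_X, eval_C] at h
  have h' := (hτ.1 x).unique ⟨h₂ x h.2, 0, by simp⟩ ⟨h₁ _ h.1, N, by simp⟩
  exact hN (Nat.cast_eq_zero.1 (sub_eq_self.1 h'.symm))

-- The minimal polynomial over `C` works: its roots are eigenvalues.
open Polynomial in
theorem exists_polynomial_aeval_eq_zero {C R Q : Type*} [Field C] [CommRing R] [Algebra C R]
    [AddCommGroup Q] [Module R Q] [Module C Q] [IsScalarTower C R Q] [Module.Finite C Q]
    (T : Module.End R Q) :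
    ∃ p : C[X], (∀ c, p.IsRoot c → T.HasEigenvalue (algebraMap C R c)) ∧
      aeval T (p.map (algebraMap C R)) = 0 := by
  let T' : Module.End C Q := T.restrictScalars C
  refine ⟨minpoly C T', fun c hc => ?_, ?_⟩
  · obtain ⟨v, hv, hv0⟩ := (Module.End.hasEigenvalue_of_isRoot hc).exists_hasEigenvector
    rw [Module.End.mem_eigenspace_iff] at hv
    refine Module.End.hasEigenvalue_of_hasEigenvector (x := v)
      ⟨Module.End.mem_eigenspace_iff.2 ?_, hv0⟩
    rw [algebraMap_smul]
    exact hv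
  · have hpow (n : ℕ) (v : Q) : (T ^ n) v = (T' ^ n) v := by
      rw [Module.End.pow_apply, Module.End.pow_apply]
      rfl
    have h (p : C[X]) (v : Q) : aeval T (p.map (algebraMap C R)) v = aeval T' p v := by
      induction p using Polynomial.induction_on' with
      | add p q hp hq =>
        simp only [Polynomial.map_add, map_add, LinearMap.add_apply, hp, hq]
      | monomial n a => simp [aeval_monomial, hpow, Module.algebraMap_end_apply]
    ext v
    rw [h, minpoly.aeval]
    rfl

/-! ### Exponents and polynomials killing the reduced residue -/

section Lattice

variable {R E : Type*} [CommRing R] [IsLocalRing R] [AddCommGroup E] [Module R E] [Module R⟦X⟧ E]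
  [Module R⸨X⸩ E] [IsScalarTower R R⟦X⟧ E] [IsScalarTower R⟦X⟧ R⸨X⸩ E]

theorem mem_specialSubmodule_iff {L : Submodule R⟦X⟧ E} {v : L} :
    v ∈ specialSubmodule L ↔ (v : E) ∈ specialIdeal R • L := by
  have h : (specialIdeal R • (⊤ : Submodule R⟦X⟧ L)).map L.subtype = specialIdeal R • L := by
    rw [Submodule.map_smul'', Submodule.map_subtype_top]
  rw [specialSubmodule, Submodule.restrictScalars_mem, ← h, Submodule.mem_map]
  exact ⟨fun hv => ⟨v, hv, rfl⟩, fun ⟨w, hw, e⟩ => Subtype.ext e ▸ hw⟩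

theorem specialSubmodule_mk_smul {L : Submodule R⟦X⟧ E} {f : R⟦X⟧} {r : R}
    (h : f - PowerSeries.C r ∈ specialIdeal R) (v : L) :
    (Submodule.Quotient.mk (f • v) : L ⧸ specialSubmodule L) =
      r • Submodule.Quotient.mk v := by
  rw [← Submodule.Quotient.mk_smul, Submodule.Quotient.eq, mem_specialSubmodule_iff]
  have h' : ((f • v - r • v : L) : E) = (f - PowerSeries.C r) • (v : E) := by
    rw [sub_smul, powerSeries_C_smul]
    rfl
  rw [h']
  exact Submodule.smul_mem_smul h v.2

open Polynomial in
theorem IsLogLattice.aeval_reducedResidue_mk {D : Connection R E} {L : Submodule R⟦X⟧ E}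
    (h : IsLogLattice D L) (p : R[X]) (v : L) :
    aeval h.reducedResidue p (Submodule.Quotient.mk v) = 0 ↔
      aeval D.toLin p (v : E) ∈ specialIdeal R • L := by
  have h₁ : (aeval h.endo p v : E) = aeval D.toLin p (v : E) :=
    map_aeval_apply_of_comm (L.restrictScalars R).subtype h.endo D.toLin (fun _ => rfl) p v
  have h₂ : (specialSubmodule L).mkQ (aeval h.endo p v) =
      aeval h.reducedResidue p ((specialSubmodule L).mkQ v) :=
    map_aeval_apply_of_comm (specialSubmodule L).mkQ h.endo h.reducedResidue (fun _ => rfl) p v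
  rw [← h₁, ← mem_specialSubmodule_iff, ← Submodule.Quotient.mk_eq_zero, ← Submodule.mkQ_apply,
    ← Submodule.mkQ_apply, h₂]

-- On an eigenvector for `c` the polynomial acts as `p(c)`, which is a unit of `R` unless it
-- vanishes.
open Polynomial in
theorem IsLogLattice.exponents_subset_of_aeval_mem {C : Type*} [Field C] [Algebra C R]
    {D : Connection R E} {L : Submodule R⟦X⟧ E} (h : IsLogLattice D L) {p : C[X]}
    (hp : ∀ v ∈ L, aeval D.toLin (p.map (algebraMap C R)) v ∈ specialIdeal R • L) :
    h.exponents C ⊆ {c | p.IsRoot c} := by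
  intro c hc
  obtain ⟨v, hv⟩ := Module.End.HasEigenvalue.exists_hasEigenvector hc
  by_contra h0
  obtain ⟨w, rfl⟩ := Submodule.Quotient.mk_surjective _ v
  have h₁ := (h.aeval_reducedResidue_mk _ w).2 (hp w w.2)
  rw [Module.End.aeval_apply_of_hasEigenvector hv, eval_map_algebraMap, aeval_algebraMap_apply] at h₁
  have hu : IsUnit (algebraMap C R (aeval c p)) := (IsUnit.mk0 _ h0).map _
  exact hv.2 ((hu.smul_eq_zero).1 h₁)

-- Because the residue field is `C`, the quotient `L / (𝔯, x) L` is finite-dimensional over `C`, so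
-- its endomorphism has a minimal polynomial.
open Polynomial in
theorem IsLogLattice.exists_polynomial {C : Type*} [Field C] [Algebra C R]
    (hR : Function.Surjective (algebraMap C (IsLocalRing.ResidueField R)))
    {D : Connection R E} {L : Submodule R⟦X⟧ E} (h : IsLogLattice D L) :
    ∃ p : C[X], (∀ c, p.IsRoot c → c ∈ h.exponents C) ∧
      ∀ v ∈ L, aeval D.toLin (p.map (algebraMap C R)) v ∈ specialIdeal R • L := by
  let _ : Module C (L ⧸ specialSubmodule L) := Module.compHom _ (algebraMap C R)
  have : IsScalarTower C R (L ⧸ specialSubmodule L) :=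
    ⟨fun c r q => by rw [Algebra.smul_def, mul_smul]; rfl⟩
  have : Module.Finite C (L ⧸ specialSubmodule L) := by
    obtain ⟨s, hs⟩ := h.finite.fg_top
    classical
    refine ⟨⟨s.image (specialSubmodule L).mkQ, ?_⟩⟩
    rw [Finset.coe_image, eq_top_iff]
    rintro q -
    obtain ⟨v, rfl⟩ := Submodule.Quotient.mk_surjective _ q
    have hv : v ∈ Submodule.span R⟦X⟧ (s : Set L) := hs ▸ Submodule.mem_top
    induction hv using Submodule.span_induction with
    | mem v hv => exact Submodule.subset_span ⟨v, hv, rfl⟩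
    | zero => exact zero_mem _
    | add v w _ _ hv hw => exact add_mem hv hw
    | smul f v _ hv =>
      obtain ⟨c, hc⟩ := exists_sub_C_mem_specialIdeal hR f
      have h₁ : (Submodule.Quotient.mk (f • v) : L ⧸ specialSubmodule L) =
          c • Submodule.Quotient.mk v := specialSubmodule_mk_smul hc v
      rw [h₁]
      exact Submodule.smul_mem _ _ hv
  obtain ⟨p, hp, hp'⟩ := exists_polynomial_aeval_eq_zero (C := C) h.reducedResidue
  refine ⟨p, hp, fun v hv => ?_⟩
  rw [← h.aeval_reducedResidue_mk _ ⟨v, hv⟩, hp']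
  rfl

end Lattice

/-! ### The lattice spanned by a rescaled Jordan basis -/

section Jordan

variable {R E : Type*} [CommRing R] [AddCommGroup E] [Module R E] [Module R⟦X⟧ E]
  [Module R⸨X⸩ E] [IsScalarTower R R⟦X⟧ E] [IsScalarTower R⟦X⟧ R⸨X⸩ E]

theorem algebraMap_powerSeries_injective : Function.Injective (algebraMap R⟦X⟧ R⸨X⸩) :=
  HahnSeries.ofPowerSeries_injective

theorem exists_sub_principalPart_eq (f : R⸨X⸩) :
    ∃ g : R⟦X⟧, f - principalPart R f = algebraMap R⟦X⟧ R⸨X⸩ g := by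
  refine ⟨PowerSeries.mk fun n => f.coeff n, ?_⟩
  ext n
  rw [LaurentSeries.coe_algebraMap, HahnSeries.coeff_sub]
  change f.coeff n - (if n < 0 then f.coeff n else 0) = _
  rcases lt_or_ge n 0 with hn | hn
  · rw [if_pos hn, sub_self]
    exact (HahnSeries.embDomain_of_notMem_range
      (by rintro ⟨m, rfl⟩; simp at hn; omega)).symm
  · lift n to ℕ using hn
    rw [HahnSeries.ofPowerSeries_apply_coeff]
    simp

theorem euler_single (k : ℤ) :
    euler R (HahnSeries.single k 1) = (k : R⸨X⸩) * HahnSeries.single k 1 := by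
  rw [← zsmul_eq_mul]
  ext n
  rw [coeff_euler, HahnSeries.coeff_smul]
  by_cases h : n = k
  · subst h; simp
  · simp [HahnSeries.coeff_single_of_ne h]

theorem isUnit_single (k : ℤ) : IsUnit (HahnSeries.single k 1 : R⸨X⸩) :=
  IsUnit.of_mul_eq_one (HahnSeries.single (-k) 1) (by simp)

variable [IsLocalRing R]

open Polynomial in
theorem Connection.exists_isLogLattice_of_isJordanFlat (D : Connection R E) {g : R⟦X⟧} {r : ℕ}
    (b : Module.Basis (Fin r) R⸨X⸩ E) (hb : IsJordanFlat (algebraMap R⟦X⟧ R⸨X⸩ g) (D.mat b))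
    (k : ℤ) (a : R) (ha : g + (k : R⟦X⟧) - PowerSeries.C a ∈ specialIdeal R) :
    ∃ L : Submodule R⟦X⟧ E, IsLogLattice D L ∧
      ∀ v ∈ L, aeval D.toLin ((X - C a) ^ r) v ∈ specialIdeal R • L := by
  -- As `ϑ(x^k) = k x^k`, the basis `x^k b i` has the same matrix with `k` added on the diagonal.
  let e : Module.Basis (Fin r) R⸨X⸩ E := b.isUnitSMul fun _ => isUnit_single k
  have he (i : Fin r) : e i = (HahnSeries.single k 1 : R⸨X⸩) • b i := b.isUnitSMul_apply _ i
  have hDe (i : Fin r) : D.toLin (e i) = (k : R⸨X⸩) • e i + ∑ j, D.mat b j i • e j := by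
    rw [he, D.leibniz, euler_single, mul_smul, ← b.sum_repr (D.toLin (b i)), Finset.smul_sum]
    congr 1
    refine Finset.sum_congr rfl fun j _ => ?_
    rw [he, smul_comm]
    rfl
  let L : Submodule R⟦X⟧ E := Submodule.span R⟦X⟧ (Set.range e)
  have heL (i : Fin r) : e i ∈ L := Submodule.subset_span ⟨i, rfl⟩
  -- A filtration from `F 0 = L` down to `F r = (𝔯, x) L`. Modulo `(𝔯, x) L`, `∇ - a` sends `e i` to
  -- `0` or `e (i + 1)`, hence `F m` into `F (m + 1)`.
  let F (m : ℕ) : Submodule R⟦X⟧ E :=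
    specialIdeal R • L ⊔ Submodule.span R⟦X⟧ (e '' {i | m ≤ (i : ℕ)})
  have hJF (m : ℕ) : specialIdeal R • L ≤ F m := le_sup_left
  have hspan (m : ℕ) : Submodule.span R⟦X⟧ (e '' {i | m ≤ (i : ℕ)}) ≤ L :=
    Submodule.span_mono (Set.image_subset_range _ _)
  have hFL (m : ℕ) : F m ≤ L := sup_le Submodule.smul_le_right (hspan m)
  have hFmono {m n : ℕ} (h : m ≤ n) : F n ≤ F m :=
    sup_le_sup_left (Submodule.span_mono (Set.image_mono fun i hi => h.trans hi)) _
  have hSe (i : Fin r) : D.toLin (e i) - a • e i ∈ F (i + 1) := by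
    have h₁ : D.toLin (e i) - a • e i = (g + (k : R⟦X⟧) - PowerSeries.C a) • e i +
        ∑ j ∈ Finset.univ.erase i, D.mat b j i • e j := by
      rw [hDe, ← Finset.add_sum_erase _ _ (Finset.mem_univ i), hb.1 i, sub_smul, add_smul,
        powerSeries_C_smul, algebraMap_smul, Int.cast_smul_eq_zsmul, Int.cast_smul_eq_zsmul]
      abel
    rw [h₁]
    refine add_mem (hJF _ (Submodule.smul_mem_smul ha (heL i))) (sum_mem fun j hj => ?_)
    have hji : j ≠ i := Finset.ne_of_mem_erase hj
    by_cases hij : (j : ℕ) = i + 1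
    · rcases hb.2.1 j i hij with h | h
      · rw [h, zero_smul]
        exact zero_mem _
      · rw [h, one_smul]
        exact Submodule.mem_sup_right (Submodule.subset_span ⟨j, hij.ge, rfl⟩)
    · rw [hb.2.2 j i hji hij, zero_smul]
      exact zero_mem _
  have hSf (f : R⟦X⟧) {v : E} {m : ℕ} (hv : v ∈ L) (h : D.toLin v - a • v ∈ F m) :
      D.toLin (f • v) - a • f • v ∈ F m := by
    have h₁ : D.toLin (f • v) - a • f • v =
        (PowerSeries.X : R⟦X⟧) • (PowerSeries.derivative R f • v) + f • (D.toLin v - a • v) := by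
      rw [D.toLin_powerSeries_smul, smul_sub, ← powerSeries_C_smul a (f • v), ← powerSeries_C_smul a v,
        smul_comm f]
      abel
    rw [h₁]
    exact add_mem (hJF _ (Submodule.smul_mem_smul X_mem_specialIdeal (L.smul_mem _ hv)))
      ((F m).smul_mem _ h)
  have hSspan (m : ℕ) {v : E} (hv : v ∈ Submodule.span R⟦X⟧ (e '' {i | m ≤ (i : ℕ)})) :
      D.toLin v - a • v ∈ F (m + 1) := by
    induction hv using Submodule.span_induction with
    | mem v hv =>
      obtain ⟨i, hi, rfl⟩ := hv
      exact hFmono (Nat.succ_le_succ hi) (hSe i)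
    | zero => simp
    | add v w _ _ hv hw =>
      convert add_mem hv hw using 1
      rw [map_add, smul_add]
      abel
    | smul f v hv' hv => exact hSf f (hspan m hv') hv
  have hL0 : Submodule.span R⟦X⟧ (e '' {i | 0 ≤ (i : ℕ)}) = L := by
    congr 1
    simp
  have hstable : ∀ v ∈ L, D.toLin v ∈ L := fun v hv => by
    rw [← sub_add_cancel (D.toLin v) (a • v)]
    exact add_mem (hFL _ (hSspan 0 (hL0 ▸ hv))) (L.smul_of_tower_mem a hv)
  have hSF (m : ℕ) {v : E} (hv : v ∈ F m) : D.toLin v - a • v ∈ F (m + 1) := by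
    obtain ⟨u, hu, w, hw, rfl⟩ := Submodule.mem_sup.1 hv
    rw [map_add, smul_add, add_sub_add_comm]
    exact add_mem (hJF _ (sub_mem (D.toLin_mem_smul hstable X_mem_specialIdeal hu)
      (Submodule.smul_of_tower_mem _ a hu))) (hSspan m hw)
  have hpow (m : ℕ) {v : E} (hv : v ∈ L) : aeval D.toLin ((X - C a) ^ m) v ∈ F m := by
    induction m with
    | zero => simpa using Submodule.mem_sup_right (hL0.symm ▸ hv)
    | succ m ih =>
      rw [pow_succ', map_mul, Module.End.mul_apply]
      simpa [Module.algebraMap_end_apply] using hSF m ih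
  have hli : LinearIndependent R⟦X⟧ e := e.linearIndependent.restrict_scalars fun f f' h => by
    simp only [Algebra.smul_def, mul_one] at h
    exact algebraMap_powerSeries_injective h
  refine ⟨L, ⟨?_, ?_, ?_, hstable⟩, fun v hv => ?_⟩
  · exact Module.Finite.of_basis (Module.Basis.span hli)
  · exact Module.Free.of_basis (Module.Basis.span hli)
  · rw [eq_top_iff, ← e.span_eq]
    exact Submodule.span_mono Submodule.subset_span
  · have hFr : F r = specialIdeal R • L := by
      have h₁ : {i : Fin r | r ≤ (i : ℕ)} = ∅ := by
        ext i
        simp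
      simp only [F, h₁, Set.image_empty, Submodule.span_empty, sup_bot_eq]
    exact hFr ▸ hpow r hv

end Jordan

/-! ### Lattices in the components `E_φ` and their sum -/

section Components

variable {R E : Type*} [CommRing R] [AddCommGroup E] [Module R E] [Module R⟦X⟧ E]
  [Module R⸨X⸩ E] [IsScalarTower R R⟦X⟧ E] [IsScalarTower R R⸨X⸩ E] [IsScalarTower R⟦X⟧ R⸨X⸩ E]

namespace TLJForm

variable {D : Connection R E} (T : TLJForm D)

/-- Subtracting the scalar `p(φ)` changes only the diagonal entry `f`, and `f - p(f)` has no polar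
part. -/
theorem exists_isJordanFlat_rsComp (φ : T.Φ) :
    ∃ (g : R⟦X⟧) (r : ℕ) (b : Module.Basis (Fin r) R⸨X⸩ (T.comp φ)),
      IsJordanFlat (algebraMap R⟦X⟧ R⸨X⸩ g) ((T.rsComp φ).mat b) := by
  obtain ⟨f, hf, r, b, hb⟩ := T.jordan φ
  obtain ⟨g, hg⟩ := exists_sub_principalPart_eq f
  have hp : Character.principalPart R (φ : Character R) = principalPart R f := by
    rw [← hf]
    rfl
  have hrs (v : T.comp φ) : (T.rsComp φ).toLin v =
      (D.restrict (T.comp φ) (T.stable φ)).toLin v - principalPart R f • v :=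
    Subtype.ext (by rw [← hp]; exact T.rs_apply v.2)
  have hmat (i j : Fin r) : (T.rsComp φ).mat b i j =
      (D.restrict (T.comp φ) (T.stable φ)).mat b i j -
        principalPart R f * (if j = i then 1 else 0) := by
    simp [Connection.mat, hrs, Module.Basis.repr_self, Finsupp.single_apply]
  have hne {i j : Fin r} (h : i ≠ j) : (T.rsComp φ).mat b i j =
      (D.restrict (T.comp φ) (T.stable φ)).mat b i j := by
    rw [hmat, if_neg h.symm, mul_zero, sub_zero]
  refine ⟨g, r, b, fun i => ?_, fun i j h => ?_, fun i j h h' => ?_⟩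
  · rw [hmat, if_pos rfl, mul_one, hb.1 i, hg]
  · rw [hne (by rintro rfl; omega)]
    exact hb.2.1 i j h
  · rw [hne h]
    exact hb.2.2 i j h h'

variable [IsLocalRing R]

open Polynomial in
theorem exists_isLogLattice_rsComp {k : Type*} [Field k] [Algebra k R]
    (hR : Function.Surjective (algebraMap k (IsLocalRing.ResidueField R))) {τ : Set k}
    (hτ : IsCosetSection τ) (φ : T.Φ) :
    ∃ a ∈ τ, ∃ (r : ℕ) (L : Submodule R⟦X⟧ (T.comp φ)), IsLogLattice (T.rsComp φ) L ∧
      ∀ v ∈ L, aeval (T.rsComp φ).toLin (((X - C a) ^ r).map (algebraMap k R)) v ∈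
        specialIdeal R • L := by
  obtain ⟨g, r, b, hb⟩ := T.exists_isJordanFlat_rsComp φ
  obtain ⟨c, hc⟩ := exists_sub_C_mem_specialIdeal hR g
  obtain ⟨a, ⟨ha, n, hn⟩, -⟩ := hτ.1 c
  -- With `c = a + n` and `g ≡ c` modulo `(𝔯, x)`, the shift that brings the exponent to `a` is
  -- `-n`.
  have hg : g + ((-n : ℤ) : R⟦X⟧) - PowerSeries.C (algebraMap k R a) ∈ specialIdeal R := by
    have h : (PowerSeries.C (algebraMap k R c) : R⟦X⟧) =
        PowerSeries.C (algebraMap k R a) + (n : R⟦X⟧) := by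
      rw [sub_eq_iff_eq_add'.1 hn, map_add, map_add, map_intCast, map_intCast]
    rw [h] at hc
    convert hc using 1
    push_cast
    ring
  obtain ⟨L, hL, hp⟩ := (T.rsComp φ).exists_isLogLattice_of_isJordanFlat b hb (-n) _ hg
  exact ⟨a, ha, r, L, hL, by simpa using hp⟩

variable (L : (φ : T.Φ) → Submodule R⟦X⟧ (T.comp φ))

theorem iSupIndep_map_subtype :
    _root_.iSupIndep fun φ => (L φ).map ((T.comp φ).subtype.restrictScalars R⟦X⟧) := by
  have hle (φ : T.Φ) : (L φ).map ((T.comp φ).subtype.restrictScalars R⟦X⟧) ≤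
      (T.comp φ).restrictScalars R⟦X⟧ := by
    rintro _ ⟨v, -, rfl⟩
    exact v.2
  intro φ
  rw [Submodule.disjoint_def]
  intro v hv hv'
  refine Submodule.disjoint_def.1 (T.iSupIndep φ) v (hle φ hv) ?_
  have h : ⨆ ψ, ⨆ (_ : ψ ≠ φ), (L ψ).map ((T.comp ψ).subtype.restrictScalars R⟦X⟧) ≤
      (⨆ ψ, ⨆ (_ : ψ ≠ φ), T.comp ψ).restrictScalars R⟦X⟧ :=
    iSup₂_le fun ψ hψ => fun _ hw =>
      le_iSup₂ (f := fun ψ (_ : ψ ≠ φ) => T.comp ψ) ψ hψ (hle ψ hw)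
  exact h hv'

variable {L}

theorem finite_iSup_map (hL : ∀ φ, IsLogLattice (T.rsComp φ) (L φ)) : Module.Finite R⟦X⟧
    ↥(⨆ φ, (L φ).map ((T.comp φ).subtype.restrictScalars R⟦X⟧)) :=
  Module.Finite.iff_fg.2 <| Submodule.fg_iSup _ fun φ =>
    (Module.Finite.iff_fg.1 (hL φ).finite).map _

theorem span_iSup_map (hL : ∀ φ, IsLogLattice (T.rsComp φ) (L φ)) : Submodule.span R⸨X⸩
    ((⨆ φ, (L φ).map ((T.comp φ).subtype.restrictScalars R⟦X⟧) : Submodule R⟦X⟧ E) : Set E) =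
      ⊤ := by
  rw [eq_top_iff, ← T.iSup_eq_top]
  refine iSup_le fun φ => ?_
  have h := congrArg (Submodule.map (T.comp φ).subtype) (hL φ).span_eq_top
  rw [Submodule.map_subtype_top, Submodule.map_span] at h
  rw [← h]
  exact Submodule.span_mono
    (le_iSup (fun φ => (L φ).map ((T.comp φ).subtype.restrictScalars R⟦X⟧)) φ)

theorem rs_mem_iSup_map (hL : ∀ φ, IsLogLattice (T.rsComp φ) (L φ)) :
    ∀ v ∈ ⨆ φ, (L φ).map ((T.comp φ).subtype.restrictScalars R⟦X⟧),
      T.rs.toLin v ∈ ⨆ φ, (L φ).map ((T.comp φ).subtype.restrictScalars R⟦X⟧) := by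
  intro v hv
  induction hv using Submodule.iSup_induction' with
  | mem φ v hv =>
    obtain ⟨w, hw, rfl⟩ := hv
    exact Submodule.mem_iSup_of_mem φ ⟨_, (hL φ).stable w hw, rfl⟩
  | zero => simp
  | add v w _ _ hv hw =>
    rw [map_add]
    exact add_mem hv hw

open Polynomial in
theorem aeval_prod_mem_smul_iSup_map (hL : ∀ φ, IsLogLattice (T.rsComp φ) (L φ)) {p : T.Φ → R[X]}
    (hp : ∀ φ, ∀ v ∈ L φ, aeval (T.rsComp φ).toLin (p φ) v ∈ specialIdeal R • L φ) :
    ∀ v ∈ ⨆ φ, (L φ).map ((T.comp φ).subtype.restrictScalars R⟦X⟧),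
      aeval T.rs.toLin (∏ φ, p φ) v ∈
        specialIdeal R • ⨆ φ, (L φ).map ((T.comp φ).subtype.restrictScalars R⟦X⟧) := by
  classical
  intro v hv
  induction hv using Submodule.iSup_induction' with
  | mem φ v hv =>
    obtain ⟨w, hw, rfl⟩ := hv
    -- On the summand of `φ` the factor `p φ` acts first and lands in `(𝔯, x)` times the sum, which
    -- the other factors preserve.
    rw [← Finset.prod_erase_mul _ _ (Finset.mem_univ φ), map_mul, Module.End.mul_apply]
    refine T.rs.aeval_mem (fun v hv => T.rs.toLin_mem_smul (T.rs_mem_iSup_map hL)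
      X_mem_specialIdeal hv) _ ?_
    have h : ((aeval (T.rsComp φ).toLin (p φ) w : T.comp φ) : E) =
        aeval T.rs.toLin (p φ) (w : E) :=
      map_aeval_apply_of_comm ((T.comp φ).subtype.restrictScalars R) (T.rsComp φ).toLin
        T.rs.toLin (fun _ => rfl) (p φ) w
    have h' := Submodule.mem_map_of_mem (f := (T.comp φ).subtype.restrictScalars R⟦X⟧)
      (hp φ w hw)
    rw [Submodule.map_smul''] at h'
    have h'' := Submodule.smul_mono le_rfl
      (le_iSup (fun φ => (L φ).map ((T.comp φ).subtype.restrictScalars R⟦X⟧)) φ) h'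
    exact h ▸ h''
  | zero => simp
  | add v w _ _ hv hw =>
    rw [map_add]
    exact add_mem hv hw

end TLJForm

end Components

end RelDisk

/-! ### The decomposition -/

open Polynomial in
theorem proposition4p11
    {C : Type*} [Field C] [IsAlgClosed C] [CharZero C]
    {R : Type*} [CommRing R] [IsDomain R] [IsDiscreteValuationRing R]
    [IsAdicComplete (IsLocalRing.maximalIdeal R) R] [Algebra C R]
    (hR : Function.Bijective (algebraMap C (IsLocalRing.ResidueField R)))
    (τ : Set C) (hτ : RelDisk.IsCosetSection τ)
    {E : Type*} [AddCommGroup E] [Module R E] [Module R⟦X⟧ E] [Module R⸨X⸩ E]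
    [IsScalarTower R R⟦X⟧ E] [IsScalarTower R R⸨X⸩ E] [IsScalarTower R⟦X⟧ R⸨X⸩ E]
    [Module.Finite R⸨X⸩ E] [Module.IsTorsionFree R E]
    (D : RelDisk.Connection R E) (T : RelDisk.TLJForm D)
    (L : Submodule R⟦X⟧ E) (hL : RelDisk.IsDeligneManinLattice τ T.rs L) :
    ∃ L' : (φ : T.Φ) → Submodule R⟦X⟧ (T.comp φ),
      (∀ φ, RelDisk.IsDeligneManinLattice τ (T.rsComp φ) (L' φ)) ∧
      iSupIndep (fun φ => (L' φ).map ((T.comp φ).subtype.restrictScalars R⟦X⟧)) ∧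
      ⨆ φ, (L' φ).map ((T.comp φ).subtype.restrictScalars R⟦X⟧) = L := by
  choose a ha r L' hL' hp' using T.exists_isLogLattice_rsComp hR.2 hτ
  obtain ⟨hlog, hexp⟩ := hL
  obtain ⟨p, hpτ, hp⟩ := hlog.exists_polynomial hR.2
  refine ⟨L', fun φ => ⟨hL' φ, ?_⟩, T.iSupIndep_map_subtype L', ?_⟩
  · intro c hc
    have h := (hL' φ).exponents_subset_of_aeval_mem (hp' φ) hc
    have hca : c = a φ := sub_eq_zero.1 (eq_zero_of_pow_eq_zero (n := r φ) (by simpa using h))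
    exact hca ▸ ha φ
  have hroot : ∀ c, (∏ φ, (X - Polynomial.C (a φ)) ^ r φ).IsRoot c → c ∈ τ := by
    intro c hc
    rw [IsRoot, eval_prod, Finset.prod_eq_zero_iff] at hc
    obtain ⟨φ, -, h⟩ := hc
    have hca : c = a φ := sub_eq_zero.1 (eq_zero_of_pow_eq_zero (n := r φ) (by simpa using h))
    exact hca ▸ ha φ
  have hq := T.aeval_prod_mem_smul_iSup_map hL' hp'
  rw [← Polynomial.map_prod] at hq
  -- Coprimality is decided by roots over the algebraically closed field `C`; the Bézout relation is
  -- then carried to `R[X]`.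
  have hcop {p₁ p₂ : C[X]} (h₁ : ∀ c, p₁.IsRoot c → c ∈ τ) (h₂ : ∀ c, p₂.IsRoot c → c ∈ τ) (N : ℕ)
      (hN : N ≠ 0) : IsCoprime ((p₁.map (algebraMap C R)).comp (X - Polynomial.C (N : R)))
        (p₂.map (algebraMap C R)) := by
    simpa [Polynomial.map_comp] using
      (RelDisk.isCoprime_comp_X_sub_C hτ h₁ h₂ hN).map (mapRingHom (algebraMap C R))
  have hpτ' : ∀ c, p.IsRoot c → c ∈ τ := fun c hc => hexp (hpτ c hc)
  have := T.finite_iSup_map hL'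
  have := hlog.finite
  exact le_antisymm
    (T.rs.le_of_isCoprime (T.rs_mem_iSup_map hL') hlog.stable hlog.span_eq_top hq hp
      (hcop hroot hpτ'))
    (T.rs.le_of_isCoprime hlog.stable (T.rs_mem_iSup_map hL') (T.span_iSup_map hL') hp hq
      (hcop hpτ' hroot))
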